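/- Let $G$ be a group with a split $BN$-pair with finite Weyl group. That is, $G$ has subgroups $B$, $N$, $U$ such that, with $T=B\cap N$: (i) $B\cup N$ generates $G$, and $T$ is normal in $N$; (ii) $W=N/T$ is finite and is generated by a set $S$ of elements of order $2$; (iii) if $n\in N$ maps to an element of $S$, then $nBn\neq B$; (iv) if $n\in N$ maps to an element of $S$ and $m\in N$, then $nBm\subseteq BnmB\cup BmB$; (v) $U$ is a normal subgroup of $B$ and $B=T\ltimes U$; (vi) $\bigcap_{n\in N}nBn^{-1}=T$. Let $k$ be a field and let $kH$ denote the group algebra of a group $H$ over $k$. Let $\theta$ be a one-dimensional representation of $T$ over $k$ with underlying module $k_\theta$, regarded also as a $B$-module through the projection $B\to B/U\cong T$. Put $M(\theta)=kG\otimes_{kB}k_\theta$ and $\mathrm{Ind}_T^Gk_\theta=kG\otimes_{kT}k_\theta$. Let $M(tr)$ be the module $M(\theta)$ for the trivial one-dimensional representation $\theta$, and let $1_{tr}=1\otimes 1\in M(tr)$. For $w=nT\in W$ the element $w1_{tr}:=n1_{tr}$ is well defined. Let $\eta=\sum_{w\in W}(-1)^{l(w)}w1_{tr}\in M(tr)$,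 where $l$ is the length function on $W$ with respect to $S$, and let $\mathrm{St}=kU\eta$ be the subspace of $M(tr)$ spanned by the elements $u\eta$, $u\in U$. Then $\mathrm{St}$ is a $G$-submodule of $M(tr)$, and there is an isomorphism of $G$-modules $$\mathrm{Ind}_T^Gk_\theta\;\xrightarrow{\ \sim\ }\;M(\theta)\otimes_k\mathrm{St},\qquad g1_\theta\longmapsto g(1_\theta\otimes\eta)\quad(g\in G),$$ where $G$ acts diagonally on the tensor product. Here, for $v\in k_\theta$ (in particular for a nonzero one), $1_\theta$ denotes the element $1\otimes v$ of $\mathrm{Ind}_T^Gk_\theta$ on the left and the element $1\otimes v$ of $M(\theta)$ on the right; the same isomorphism serves all $v$. -/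

import Mathlib

open scoped TensorProduct

/-- A `BN`-pair (Tits system) in a group `G`. Here `T = B ∩ N` is a normal subgroup of `N`,
`W = N / T`, and `S` is the distinguished set of generators of `W`. -/
structure BNPair (G : Type*) [Group G] where
  B : Subgroup G
  N : Subgroup G
  closure_union : Subgroup.closure ((B : Set G) ∪ (N : Set G)) = ⊤
  normal_T : ((B ⊓ N).subgroupOf N).Normal
  S : Set (N ⧸ (B ⊓ N).subgroupOf N)
  closure_S : Subgroup.closure S = ⊤
  orderOf_S : ∀ s ∈ S, orderOf s = 2
  /-- If `n ∈ N` represents an element of `S`, then `n B n ≠ B`. -/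
  conj_ne : ∀ n : N, (QuotientGroup.mk n : N ⧸ (B ⊓ N).subgroupOf N) ∈ S →
    (fun b : G => (n : G) * b * (n : G)) '' (B : Set G) ≠ (B : Set G)
  /-- If `n ∈ N` represents an element of `S` and `m ∈ N`, then `n B m ⊆ B n m B ∪ B m B`. -/
  mul_subset : ∀ n : N, (QuotientGroup.mk n : N ⧸ (B ⊓ N).subgroupOf N) ∈ S → ∀ m : N,
    (fun b : G => (n : G) * b * (m : G)) '' (B : Set G) ⊆
      DoubleCoset.doubleCoset ((n : G) * (m : G)) (B : Set G) (B : Set G) ∪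
        DoubleCoset.doubleCoset (m : G) (B : Set G) (B : Set G)

namespace BNPair

variable {G : Type*} [Group G] (P : BNPair G)

/-- The subgroup `T = B ∩ N`. -/
abbrev T : Subgroup G := P.B ⊓ P.N

instance : (P.T.subgroupOf P.N).Normal := P.normal_T

/-- The Weyl group `W = N / T`. -/
abbrev W : Type _ := P.N ⧸ P.T.subgroupOf P.N

/-- The length of `w ∈ W`: the least length of a word in `S` with product `w`. -/
noncomputable def length (w : P.W) : ℕ :=
  sInf {n : ℕ | ∃ L : List P.W, (∀ s ∈ L, s ∈ P.S) ∧ L.prod = w ∧ L.length = n}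

end BNPair

/-- A split `BN`-pair: `B` is the semidirect product `T ⋉ U` with `U` normal in `B`, and the
intersection of all `n B n⁻¹`, `n ∈ N`, is `T`. -/
structure SplitBNPair (G : Type*) [Group G] extends BNPair G where
  U : Subgroup G
  U_le : U ≤ B
  normal_U : (U.subgroupOf B).Normal
  U_inf_T : U ⊓ (B ⊓ N) = ⊥
  U_sup_T : U ⊔ (B ⊓ N) = B
  iInf_conj : ⨅ n : N, B.map (MulAut.conj (n : G)).toMonoidHom = B ⊓ N

namespace SplitBNPair

variable {G : Type*} [Group G] (P : SplitBNPair G)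

instance : (P.U.subgroupOf P.B).Normal := P.normal_U

theorem T_le_B : P.T ≤ P.B := inf_le_left

theorem isComplement : (P.T.subgroupOf P.B).IsComplement' (P.U.subgroupOf P.B) := by
  apply Subgroup.isComplement'_of_disjoint_and_mul_eq_univ
  · rw [disjoint_iff]
    have h : P.U ⊓ P.T = ⊥ := P.U_inf_T
    ext x
    simp only [Subgroup.mem_inf, Subgroup.mem_subgroupOf, Subgroup.mem_bot]
    constructor
    · intro hx
      have : (x : G) ∈ P.U ⊓ P.T := by
        simp only [Subgroup.mem_inf] at hx ⊢
        tauto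
      rw [h, Subgroup.mem_bot] at this
      exact Subtype.ext this
    · rintro rfl
      simp [P.U.one_mem, P.B.one_mem]
  · rw [← Subgroup.mul_normal, ← Subgroup.subgroupOf_sup P.T_le_B P.U_le]
    have h : P.T ⊔ P.U = P.B := by rw [sup_comm]; exact P.U_sup_T
    rw [h, Subgroup.subgroupOf_self]
    rfl

/-- The projection `B → T` of the semidirect product `B = T ⋉ U`, with kernel `U`. -/
noncomputable def proj : P.B →* P.T :=
  (Subgroup.subgroupOfEquivOfLe P.T_le_B).toMonoidHom.comp
    (P.isComplement.QuotientMulEquiv.toMonoidHom.comp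
      (QuotientGroup.mk' (P.U.subgroupOf P.B)))

theorem proj_of_mem_T (b : P.B) (hb : (b : G) ∈ P.T) : P.proj b = ⟨b, hb⟩ := by
  have h : P.isComplement.QuotientMulEquiv (QuotientGroup.mk' (P.U.subgroupOf P.B) b) =
      (⟨b, hb⟩ : P.T.subgroupOf P.B) := by
    rw [← MulEquiv.eq_symm_apply]
    rfl
  change Subgroup.subgroupOfEquivOfLe P.T_le_B (P.isComplement.QuotientMulEquiv
    (QuotientGroup.mk' (P.U.subgroupOf P.B) b)) = _
  rw [h]
  rfl

theorem proj_of_mem_U (b : P.B) (hb : (b : G) ∈ P.U) : P.proj b = 1 := by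
  have h : QuotientGroup.mk' (P.U.subgroupOf P.B) b = 1 :=
    (QuotientGroup.eq_one_iff b).2 hb
  simp only [proj, MonoidHom.comp_apply, h, map_one]

variable {k : Type*} [Field k] {V : Type*} [AddCommGroup V] [Module k V]

/-- The space of `M(θ) = k G ⊗_{k B} k_θ`, where the representation `θ` of `T` is regarded as a
representation of `B` through `B → T`. -/
abbrev MSpace (θ : Representation k P.T V) : Type _ :=
  Representation.IndV P.B.subtype (θ.comp P.proj)

/-- The representation `M(θ) = k G ⊗_{k B} k_θ` of `G`. -/
noncomputable abbrev M (θ : Representation k P.T V) : Representation k G (P.MSpace θ) :=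
  Representation.ind P.B.subtype (θ.comp P.proj)

/-- The element `1 ⊗ v` of `M(θ)`. -/
noncomputable abbrev M.one (θ : Representation k P.T V) (v : V) : P.MSpace θ :=
  Representation.IndV.mk P.B.subtype (θ.comp P.proj) 1 v

/-- The representation `Ind_T^G k_θ = k G ⊗_{k T} k_θ` of `G`. -/
noncomputable abbrev indT (θ : Representation k P.T V) :
    Representation k G (Representation.IndV P.T.subtype θ) :=
  Representation.ind P.T.subtype θ

/-- The element `1 ⊗ v` of `Ind_T^G k_θ`. -/
noncomputable abbrev indT.one (θ : Representation k P.T V) (v : V) :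
    Representation.IndV P.T.subtype θ :=
  Representation.IndV.mk P.T.subtype θ 1 v

variable (k)

/-- The trivial one-dimensional representation of `T`. -/
abbrev tr : Representation k P.T k := Representation.trivial k P.T k

/-- The element `1_tr = 1 ⊗ 1` of `M(tr)`. -/
noncomputable def oneTr : P.MSpace (P.tr k) := M.one P (P.tr k) 1

theorem M_tr_oneTr (t : G) (ht : t ∈ P.T) : P.M (P.tr k) t (P.oneTr k) = P.oneTr k := by
  have h := (Representation.Coinvariants.mk_self_apply
    (Representation.tprod ((Representation.leftRegular k G).comp P.B.subtype)
      ((P.tr k).comp P.proj)) ⟨t, P.T_le_B ht⟩⁻¹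
    (MonoidAlgebra.single (1 : G) (1 : k) ⊗ₜ[k] (1 : k)))
  rw [oneTr, M, M.one, Representation.ind_mk]
  simpa using h

/-- The element `w 1_tr = n 1_tr` of `M(tr)`, where `n ∈ N` is any representative of `w ∈ W`. -/
noncomputable def weylTr (w : P.W) : P.MSpace (P.tr k) :=
  Quotient.liftOn' w (fun n : P.N => P.M (P.tr k) (n : G) (P.oneTr k)) (by
    intro m n h
    have ht : (m : G)⁻¹ * n ∈ P.T := by
      have h1 := QuotientGroup.leftRel_apply.1 h
      rw [Subgroup.mem_subgroupOf] at h1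
      exact h1
    have h2 : (n : G) = m * ((m : G)⁻¹ * n) := by group
    change P.M (P.tr k) (m : G) (P.oneTr k) = P.M (P.tr k) (n : G) (P.oneTr k)
    rw [h2, map_mul, Module.End.mul_apply, P.M_tr_oneTr k _ ht])

/-- The element `η = ∑_{w ∈ W} (-1)^{l(w)} w 1_tr` of `M(tr)`. -/
noncomputable def eta [Fintype P.W] : P.MSpace (P.tr k) :=
  ∑ w : P.W, (-1 : k) ^ P.length w • P.weylTr k w

/-- The subspace `k U η` of `M(tr)`. -/
noncomputable def steinbergSpace [Fintype P.W] : Submodule k (P.MSpace (P.tr k)) :=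
  Submodule.span k (Set.range fun u : P.U => P.M (P.tr k) (u : G) (P.eta k))

theorem eta_mem [Fintype P.W] : P.eta k ∈ P.steinbergSpace k :=
  Submodule.subset_span ⟨1, by
    change P.M (P.tr k) (1 : G) (P.eta k) = P.eta k
    rw [map_one, Module.End.one_apply]⟩

/-- The Steinberg module `St = k U η`, a subrepresentation of `M(tr)` as soon as the subspace
`k U η` is known to be `G`-stable. -/
noncomputable def steinberg [Fintype P.W]
    (h : ∀ (g : G), ∀ x ∈ P.steinbergSpace k, P.M (P.tr k) g x ∈ P.steinbergSpace k) :
    Representation k G (P.steinbergSpace k) :=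
  Subrepresentation.toRepresentation (ρ := P.M (P.tr k))
    ⟨P.steinbergSpace k, fun g x hx => h g x hx⟩

end SplitBNPair

/-! ### The length function on `W`. -/

namespace BNPair

variable {G : Type*} [Group G] (P : BNPair G)

/-! Once `St` is known to be a `G`-module with basis `u η`, `u ∈ U`, the rest is the tensor
identity. Since `T` fixes `η`, the group `B` permutes this basis as it permutes `B / T`, so `St`
restricted to `B` is the trivial representation induced from `T` to `B`. Hence `M(θ) ⊗ St` is
induced from `θ ⊗ Ind_T^B 1 = Ind_T^B θ`, and is `Ind_T^G θ` by transitivity. The code writes down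
the map and its inverse explicitly.

Stability under `G` is a rank one computation (`M_tr_mem_of_mem_S`). For `s ∈ S` write `η = h - s
h`, where `h` is the part of the sum with `l(s w) > l(w)`; then `s η = -η`. Elements of `B` fixing
the chamber of `s w₀` fix `h`, and every element of `B` is such a `y` times some `c` with `s c s⁻¹ ∈
B`. If `s y s = u s z` with `u`, `z` fixing `h`, then `s y η = u η - η`.

Linear independence comes from the big cell: the cosets `u w₀ B` are distinct because `B ∩ w₀ B w₀⁻¹
= T` meets `U` trivially, and `u η` involves exactly one of them.

Both rest on Tits' theory of `BN`-pairs: disjoint Bruhat cells, the product rule for cells, the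
exchange condition and the longest element. -/

theorem mul_self_of_mem_S {s : P.W} (hs : s ∈ P.S) : s * s = 1 := by
  rw [← sq, ← P.orderOf_S s hs, pow_orderOf_eq_one]

theorem inv_of_mem_S {s : P.W} (hs : s ∈ P.S) : s⁻¹ = s :=
  inv_eq_of_mul_eq_one_left (P.mul_self_of_mem_S hs)

theorem ne_one_of_mem_S {s : P.W} (hs : s ∈ P.S) : s ≠ 1 := by
  rintro rfl
  simpa using P.orderOf_S 1 hs

theorem mul_mul_cancel_of_mem_S {s : P.W} (hs : s ∈ P.S) (w : P.W) : s * (s * w) = w := by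
  rw [← mul_assoc, P.mul_self_of_mem_S hs, one_mul]

theorem mul_mul_cancel_right_of_mem_S {s : P.W} (hs : s ∈ P.S) (w : P.W) : w * s * s = w := by
  rw [mul_assoc, P.mul_self_of_mem_S hs, mul_one]

theorem exists_list_length_eq (w : P.W) :
    ∃ L : List P.W, (∀ s ∈ L, s ∈ P.S) ∧ L.prod = w ∧ L.length = P.length w := by
  refine Nat.sInf_mem (s := {n : ℕ | ∃ L : List P.W, (∀ s ∈ L, s ∈ P.S) ∧ L.prod = w ∧
    L.length = n}) ?_
  have hw : w ∈ (Subgroup.closure P.S).toSubmonoid := by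
    rw [P.closure_S]
    trivial
  rw [Subgroup.closure_toSubmonoid] at hw
  obtain ⟨L, hL, rfl⟩ := Submonoid.exists_list_of_mem_closure hw
  refine ⟨L.length, L, fun s hs => ?_, rfl, rfl⟩
  rcases hL s hs with h | h
  · exact h
  · rw [← inv_inv s, P.inv_of_mem_S (Set.mem_inv.1 h)]
    exact h

theorem length_prod_le {L : List P.W} (hL : ∀ s ∈ L, s ∈ P.S) : P.length L.prod ≤ L.length :=
  Nat.sInf_le ⟨L, hL, rfl, rfl⟩

theorem length_one : P.length 1 = 0 := by
  simpa using P.length_prod_le (L := []) (by simp)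

theorem length_mul_le (v w : P.W) : P.length (v * w) ≤ P.length v + P.length w := by
  obtain ⟨L, hL, rfl, h⟩ := P.exists_list_length_eq v
  obtain ⟨L', hL', rfl, h'⟩ := P.exists_list_length_eq w
  rw [← h, ← h', ← List.prod_append, ← List.length_append]
  exact P.length_prod_le fun s hs => (List.mem_append.1 hs).elim (hL s) (hL' s)

theorem length_le_one_of_mem_S {s : P.W} (hs : s ∈ P.S) : P.length s ≤ 1 := by
  simpa using P.length_prod_le (L := [s]) (by simpa using hs)

theorem eq_one_of_length_eq_zero {w : P.W} (h : P.length w = 0) : w = 1 := by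
  obtain ⟨L, -, rfl, h'⟩ := P.exists_list_length_eq w
  rw [h, List.length_eq_zero_iff] at h'
  rw [h', List.prod_nil]

theorem mem_S_of_length_eq_one {w : P.W} (h : P.length w = 1) : w ∈ P.S := by
  obtain ⟨L, hL, rfl, h'⟩ := P.exists_list_length_eq w
  rw [h, List.length_eq_one_iff] at h'
  obtain ⟨a, rfl⟩ := h'
  simpa using hL a (by simp)

theorem length_inv_le (w : P.W) : P.length w⁻¹ ≤ P.length w := by
  obtain ⟨L, hL, rfl, h⟩ := P.exists_list_length_eq w
  rw [List.prod_inv_reverse, ← h]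
  refine (P.length_prod_le fun s hs => ?_).trans (by simp)
  simp only [List.mem_reverse, List.mem_map] at hs
  obtain ⟨a, ha, rfl⟩ := hs
  rw [P.inv_of_mem_S (hL a ha)]
  exact hL a ha

theorem length_inv (w : P.W) : P.length w⁻¹ = P.length w :=
  (P.length_inv_le w).antisymm (by simpa using P.length_inv_le w⁻¹)

theorem length_mem_S_mul_le {s : P.W} (hs : s ∈ P.S) (w : P.W) :
    P.length (s * w) ≤ P.length w + 1 := by
  have := P.length_mul_le s w
  have := P.length_le_one_of_mem_S hs
  omega

theorem length_mul_mem_S_le {s : P.W} (hs : s ∈ P.S) (w : P.W) :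
    P.length (w * s) ≤ P.length w + 1 := by
  have := P.length_mul_le w s
  have := P.length_le_one_of_mem_S hs
  omega

theorem length_le_length_mem_S_mul {s : P.W} (hs : s ∈ P.S) (w : P.W) :
    P.length w ≤ P.length (s * w) + 1 := by
  simpa [P.mul_mul_cancel_of_mem_S hs] using P.length_mem_S_mul_le hs (s * w)

theorem exists_eq_mem_S_mul {w : P.W} (hw : P.length w ≠ 0) :
    ∃ s ∈ P.S, ∃ v, w = s * v ∧ P.length w = P.length v + 1 := by
  obtain ⟨L, hL, rfl, h⟩ := P.exists_list_length_eq w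
  cases L with
  | nil => exact absurd P.length_one hw
  | cons a L =>
    refine ⟨a, hL a (by simp), L.prod, by simp, ?_⟩
    have h1 := P.length_prod_le (L := L) fun s hs => hL s (by simp [hs])
    have h2 := P.length_mem_S_mul_le (hL a (by simp)) L.prod
    simp only [List.prod_cons, List.length_cons] at h h2 ⊢
    omega

theorem exists_eq_mul_mem_S {w : P.W} (hw : P.length w ≠ 0) :
    ∃ s ∈ P.S, ∃ v, w = v * s ∧ P.length w = P.length v + 1 := by
  obtain ⟨s, hs, v, h, hl⟩ := P.exists_eq_mem_S_mul (w := w⁻¹) (by rwa [P.length_inv])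
  refine ⟨s, hs, v⁻¹, ?_, ?_⟩
  · rw [← inv_inv w, h, mul_inv_rev, P.inv_of_mem_S hs]
  · rwa [P.length_inv] at hl ⊢

/-! ### Bruhat cells and their products. -/

/-- The Bruhat cell `B w B`. -/
def bruhatCell (w : P.W) : Set G :=
  {g | ∃ b ∈ P.B, ∃ b' ∈ P.B, ∃ n : P.N, (QuotientGroup.mk n : P.W) = w ∧ g = b * n * b'}

variable {P}

theorem coe_mem_bruhatCell (n : P.N) : (n : G) ∈ P.bruhatCell (QuotientGroup.mk n) :=
  ⟨1, P.B.one_mem, 1, P.B.one_mem, n, rfl, by simp⟩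

theorem mul_mem_bruhatCell {w : P.W} {b g : G} (hb : b ∈ P.B) (hg : g ∈ P.bruhatCell w) :
    b * g ∈ P.bruhatCell w := by
  obtain ⟨c, hc, c', hc', n, hn, rfl⟩ := hg
  exact ⟨b * c, P.B.mul_mem hb hc, c', hc', n, hn, by group⟩

theorem mem_bruhatCell_mul {w : P.W} {b g : G} (hg : g ∈ P.bruhatCell w) (hb : b ∈ P.B) :
    g * b ∈ P.bruhatCell w := by
  obtain ⟨c, hc, c', hc', n, hn, rfl⟩ := hg
  exact ⟨c, hc, c' * b, P.B.mul_mem hc' hb, n, hn, by group⟩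

theorem mul_mem_bruhatCell_iff {w : P.W} {b g : G} (hb : b ∈ P.B) :
    b * g ∈ P.bruhatCell w ↔ g ∈ P.bruhatCell w :=
  ⟨fun h => by simpa using mul_mem_bruhatCell (P.B.inv_mem hb) h, mul_mem_bruhatCell hb⟩

theorem mem_bruhatCell_mul_iff {w : P.W} {b g : G} (hb : b ∈ P.B) :
    g * b ∈ P.bruhatCell w ↔ g ∈ P.bruhatCell w :=
  ⟨fun h => by simpa using mem_bruhatCell_mul h (P.B.inv_mem hb), fun h => mem_bruhatCell_mul h hb⟩

theorem mk_eq_iff {n m : P.N} :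
    (QuotientGroup.mk n : P.W) = QuotientGroup.mk m ↔ (n : G)⁻¹ * m ∈ P.T := by
  rw [QuotientGroup.eq, Subgroup.mem_subgroupOf]
  rfl

theorem exists_of_mem_bruhatCell {g : G} (n : P.N) (hg : g ∈ P.bruhatCell (QuotientGroup.mk n)) :
    ∃ b ∈ P.B, ∃ b' ∈ P.B, g = b * n * b' := by
  obtain ⟨c, hc, c', hc', m, hm, rfl⟩ := hg
  have h := mk_eq_iff.1 hm.symm
  exact ⟨c, hc, (n : G)⁻¹ * m * c', P.B.mul_mem h.1 hc', by group⟩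

theorem inv_mem_bruhatCell {w : P.W} {g : G} (hg : g ∈ P.bruhatCell w) :
    g⁻¹ ∈ P.bruhatCell w⁻¹ := by
  obtain ⟨c, hc, c', hc', m, rfl, rfl⟩ := hg
  exact ⟨c'⁻¹, P.B.inv_mem hc', c⁻¹, P.B.inv_mem hc, m⁻¹, rfl, by simp [mul_assoc]⟩

theorem mem_bruhatCell_one {g : G} : g ∈ P.bruhatCell 1 ↔ g ∈ P.B := by
  refine ⟨fun h => ?_, fun h => ?_⟩
  · obtain ⟨b, hb, b', hb', rfl⟩ := exists_of_mem_bruhatCell (1 : P.N) h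
    simpa using P.B.mul_mem hb hb'
  · simpa using mul_mem_bruhatCell h (coe_mem_bruhatCell (1 : P.N))

theorem mul_mem_bruhatCell_or {s w : P.W} (hs : s ∈ P.S) {g h : G} (hg : g ∈ P.bruhatCell s)
    (hh : h ∈ P.bruhatCell w) : g * h ∈ P.bruhatCell (s * w) ∨ g * h ∈ P.bruhatCell w := by
  obtain ⟨a, ha, a', ha', n, rfl, rfl⟩ := hg
  obtain ⟨c, hc, c', hc', m, rfl, rfl⟩ := hh
  have key := P.mul_subset n hs m ⟨a' * c, P.B.mul_mem ha' hc, rfl⟩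
  have e : a * n * a' * (c * m * c') = a * ((n : G) * (a' * c) * m * c') := by group
  rw [e, mul_mem_bruhatCell_iff ha, mul_mem_bruhatCell_iff ha, mem_bruhatCell_mul_iff hc',
    mem_bruhatCell_mul_iff hc']
  rcases key with key | key
  · obtain ⟨x, hx, y, hy, e⟩ := DoubleCoset.mem_doubleCoset.1 key
    exact Or.inl ⟨x, hx, y, hy, n * m, rfl, e⟩
  · obtain ⟨x, hx, y, hy, e⟩ := DoubleCoset.mem_doubleCoset.1 key
    exact Or.inr ⟨x, hx, y, hy, m, rfl, e⟩

theorem mem_bruhatCell_mul_or {s w : P.W} (hs : s ∈ P.S) {g h : G} (hg : g ∈ P.bruhatCell w)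
    (hh : h ∈ P.bruhatCell s) : g * h ∈ P.bruhatCell (w * s) ∨ g * h ∈ P.bruhatCell w := by
  have hh' := inv_mem_bruhatCell hh
  rw [P.inv_of_mem_S hs] at hh'
  rcases mul_mem_bruhatCell_or hs hh' (inv_mem_bruhatCell hg) with h | h
  · left
    simpa [P.inv_of_mem_S hs] using inv_mem_bruhatCell h
  · right
    simpa using inv_mem_bruhatCell h

theorem bruhatCell_subset {v w : P.W} {g : G} (hv : g ∈ P.bruhatCell v) (hw : g ∈ P.bruhatCell w) :
    P.bruhatCell v ⊆ P.bruhatCell w := by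
  obtain ⟨b, hb, b', hb', n, rfl, rfl⟩ := hv
  rw [mem_bruhatCell_mul_iff hb', mul_mem_bruhatCell_iff hb] at hw
  intro x hx
  obtain ⟨c, hc, c', hc', rfl⟩ := exists_of_mem_bruhatCell n hx
  exact mem_bruhatCell_mul (mul_mem_bruhatCell hc hw) hc'

theorem exists_coe_eq (w : P.W) : ∃ n : P.N, QuotientGroup.mk n = w :=
  QuotientGroup.mk_surjective w

/-- Induction on the length of the shorter element. Stripping a first letter `s` from `v = s v'`
puts a representative of `v'` in the cell of `s w` or of `w`; the induction hypothesis gives `v' = s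
w`, or `v' = w`, which is too short. -/
theorem eq_of_mem_bruhatCell_aux (m : ℕ) : ∀ (v w : P.W) (g : G), P.length v = m →
    P.length v ≤ P.length w → g ∈ P.bruhatCell v → g ∈ P.bruhatCell w → v = w := by
  induction m with
  | zero =>
    intro v w g hv _ hgv hgw
    obtain rfl := P.eq_one_of_length_eq_zero hv
    obtain ⟨n, rfl⟩ := exists_coe_eq w
    have h := bruhatCell_subset hgw hgv (coe_mem_bruhatCell n)
    rw [mem_bruhatCell_one] at h
    exact mk_eq_iff.2 (by simpa using h)
  | succ m ih =>
    intro v w g hv hvw hgv hgw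
    obtain ⟨s, hs, v, rfl, hl⟩ := P.exists_eq_mem_S_mul (w := v) (by omega)
    obtain ⟨a, rfl⟩ := exists_coe_eq s
    obtain ⟨c, rfl⟩ := exists_coe_eq v
    have h1 := bruhatCell_subset hgv hgw (coe_mem_bruhatCell (a * c))
    have ha := inv_mem_bruhatCell (coe_mem_bruhatCell a)
    rw [P.inv_of_mem_S hs] at ha
    have h2 := mul_mem_bruhatCell_or hs ha h1
    have e : (a : G)⁻¹ * ((a * c : P.N) : G) = c := by simp
    rw [e] at h2
    have hle := P.length_le_length_mem_S_mul hs w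
    rcases h2 with h2 | h2
    · have := ih _ _ _ (by omega) (by omega) (coe_mem_bruhatCell c) h2
      rw [this, P.mul_mul_cancel_of_mem_S hs]
    · have := ih _ _ _ (by omega) (by omega) (coe_mem_bruhatCell c) h2
      rw [this] at hl hvw
      omega

/-- Distinct Bruhat cells are disjoint. -/
theorem eq_of_mem_bruhatCell {v w : P.W} {g : G} (hv : g ∈ P.bruhatCell v)
    (hw : g ∈ P.bruhatCell w) : v = w := by
  rcases le_total (P.length v) (P.length w) with h | h
  · exact eq_of_mem_bruhatCell_aux _ v w g rfl h hv hw
  · exact (eq_of_mem_bruhatCell_aux _ w v g rfl h hw hv).symm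

/-- Induction on `w = v r`, removing the last letter: if `g h` lay in the cell of `w`, cancelling
`r` would place an element of `B s v B` in the cell of `v` or of `v r`, so `s v = v` or `s v = v r`;
both are impossible. The inequality is weak because `length_mem_S_mul_ne` is deduced from this. -/
theorem mul_mem_bruhatCell_of_le_aux (m : ℕ) : ∀ (s w : P.W) (g h : G), s ∈ P.S →
    P.length w = m → P.length w ≤ P.length (s * w) → g ∈ P.bruhatCell s → h ∈ P.bruhatCell w →
    g * h ∈ P.bruhatCell (s * w) := by
  induction m with
  | zero =>
    intro s w g h hs hw _ hg hh
    obtain rfl := P.eq_one_of_length_eq_zero hw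
    rw [mul_one]
    exact mem_bruhatCell_mul hg (mem_bruhatCell_one.1 hh)
  | succ m ih =>
    intro s w g h hs hw hle hg hh
    refine (mul_mem_bruhatCell_or hs hg hh).resolve_right fun hgh => ?_
    obtain ⟨r, hr, v, rfl, hl⟩ := P.exists_eq_mul_mem_S (w := w) (by omega)
    obtain ⟨a, rfl⟩ := exists_coe_eq r
    obtain ⟨c, rfl⟩ := exists_coe_eq v
    obtain ⟨b, hb, b', hb', rfl⟩ := exists_of_mem_bruhatCell (c * a) hh
    rw [← mul_assoc, mem_bruhatCell_mul_iff hb'] at hgh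
    have ha := inv_mem_bruhatCell (coe_mem_bruhatCell a)
    rw [P.inv_of_mem_S hr] at ha
    have h2 := mem_bruhatCell_mul_or hr hgh ha
    have e : g * (b * ((c * a : P.N) : G)) * (a : G)⁻¹ = g * (b * c) := by simp [mul_assoc]
    rw [e, P.mul_mul_cancel_right_of_mem_S hr] at h2
    have h3 := P.length_mul_mem_S_le hr (s * QuotientGroup.mk c)
    rw [← mul_assoc] at hle
    have h4 := ih s _ g (b * c) hs (by omega) (by omega) hg
      (mul_mem_bruhatCell hb (coe_mem_bruhatCell c))
    rcases h2 with h2 | h2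
    · have := eq_of_mem_bruhatCell h4 h2
      exact P.ne_one_of_mem_S hs (mul_eq_right.1 this)
    · have := eq_of_mem_bruhatCell h4 h2
      rw [this, P.mul_mul_cancel_right_of_mem_S hr] at hle
      omega

theorem mul_mem_bruhatCell_of_le {s w : P.W} (hs : s ∈ P.S) (hle : P.length w ≤ P.length (s * w))
    {g h : G} (hg : g ∈ P.bruhatCell s) (hh : h ∈ P.bruhatCell w) :
    g * h ∈ P.bruhatCell (s * w) :=
  mul_mem_bruhatCell_of_le_aux _ s w g h hs rfl hle hg hh

theorem mem_bruhatCell_mul_of_le {s w : P.W} (hs : s ∈ P.S) (hle : P.length w ≤ P.length (w * s))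
    {g h : G} (hg : g ∈ P.bruhatCell w) (hh : h ∈ P.bruhatCell s) :
    g * h ∈ P.bruhatCell (w * s) := by
  have hh' := inv_mem_bruhatCell hh
  rw [P.inv_of_mem_S hs] at hh'
  have := mul_mem_bruhatCell_of_le (w := w⁻¹) hs (by
    rw [P.length_inv, ← P.length_inv (s * w⁻¹)]
    simpa [P.inv_of_mem_S hs] using hle) hh' (inv_mem_bruhatCell hg)
  simpa [P.inv_of_mem_S hs] using inv_mem_bruhatCell this

theorem mul_self_mem_T {n : P.N} (hn : (QuotientGroup.mk n : P.W) ∈ P.S) :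
    (n : G) * n ∈ P.T := by
  have := P.mul_self_of_mem_S hn
  rw [← QuotientGroup.mk_mul, eq_comm, ← QuotientGroup.mk_one, mk_eq_iff] at this
  simpa using this

/-- This is where the axiom `n B n ≠ B` enters: otherwise `n B n ⊆ B`, and `n² ∈ B` turns the
inclusion into an equality. -/
theorem exists_mul_mul_mem_bruhatCell (n : P.N) (hn : (QuotientGroup.mk n : P.W) ∈ P.S) :
    ∃ b ∈ P.B, (n : G) * b * n ∈ P.bruhatCell (QuotientGroup.mk n) := by
  by_contra! hcon
  have hn2 : (n : G) * n ∈ P.B := (mul_self_mem_T hn).1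
  have key : ∀ b ∈ P.B, (n : G) * b * n ∈ P.B := by
    intro b hb
    have h := mul_mem_bruhatCell_or hn (coe_mem_bruhatCell n)
      (mul_mem_bruhatCell hb (coe_mem_bruhatCell n))
    rw [← mul_assoc, P.mul_self_of_mem_S hn, mem_bruhatCell_one] at h
    exact h.resolve_right (hcon b hb)
  refine P.conj_ne n hn (Set.Subset.antisymm ?_ ?_)
  · rintro _ ⟨b, hb, rfl⟩
    exact key b hb
  · intro b hb
    -- The witness is `n⁻¹ b n⁻¹`, written so that membership in `B` is visible.
    refine ⟨((n : G) * n)⁻¹ * (n * b * n) * ((n : G) * n)⁻¹, ?_, ?_⟩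
    · exact P.B.mul_mem (P.B.mul_mem (P.B.inv_mem hn2) (key b hb)) (P.B.inv_mem hn2)
    · simp only
      group

/-- With equal lengths the product rule applies to both `w` and `s w`. For `b` with `n b n ∈ B s B`,
the element `n b m` would then lie in both `B s w B` and `B s (s w) B = B w B`. -/
theorem length_mem_S_mul_ne {s : P.W} (hs : s ∈ P.S) (w : P.W) :
    P.length (s * w) ≠ P.length w := by
  intro h
  obtain ⟨a, rfl⟩ := exists_coe_eq s
  obtain ⟨c, rfl⟩ := exists_coe_eq w
  obtain ⟨b, hb, hab⟩ := exists_mul_mul_mem_bruhatCell a hs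
  have h1 := mul_mem_bruhatCell_of_le hs h.ge (coe_mem_bruhatCell a)
    (mul_mem_bruhatCell hb (coe_mem_bruhatCell c))
  have hac := coe_mem_bruhatCell (a⁻¹ * c)
  rw [QuotientGroup.mk_mul, QuotientGroup.mk_inv, P.inv_of_mem_S hs] at hac
  have h2 := mul_mem_bruhatCell_of_le hs
    (by rw [P.mul_mul_cancel_of_mem_S hs]; exact h.le) hab hac
  have e : (a : G) * b * a * ((a⁻¹ * c : P.N) : G) = a * (b * c) := by simp [mul_assoc]
  rw [P.mul_mul_cancel_of_mem_S hs, e] at h2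
  exact P.ne_one_of_mem_S hs (mul_eq_right.1 (eq_of_mem_bruhatCell h1 h2))

theorem length_mem_S_mul {s : P.W} (hs : s ∈ P.S) (w : P.W) :
    P.length (s * w) = P.length w + 1 ∨ P.length (s * w) + 1 = P.length w := by
  have h1 := length_mem_S_mul_ne hs w
  have h2 := P.length_mem_S_mul_le hs w
  have h3 := P.length_le_length_mem_S_mul hs w
  omega

theorem exists_mul_mem_bruhatCell_of_lt {s w : P.W} (hs : s ∈ P.S)
    (hlt : P.length (s * w) < P.length w) (n : P.N) (hn : QuotientGroup.mk n = s)
    (m : P.N) (hm : QuotientGroup.mk m = w) :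
    ∃ b ∈ P.B, (n : G) * (b * m) ∈ P.bruhatCell w := by
  subst hn hm
  obtain ⟨b, hb, hab⟩ := exists_mul_mul_mem_bruhatCell n hs
  refine ⟨b, hb, ?_⟩
  have hm : (n : G)⁻¹ * m ∈ P.bruhatCell (QuotientGroup.mk n * QuotientGroup.mk m) := by
    have := coe_mem_bruhatCell (n⁻¹ * m)
    rw [QuotientGroup.mk_mul, QuotientGroup.mk_inv, P.inv_of_mem_S hs] at this
    exact this
  have h2 := mul_mem_bruhatCell_of_le hs
    (by rw [P.mul_mul_cancel_of_mem_S hs]; exact hlt.le) hab hm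
  have e : (n : G) * b * n * ((n : G)⁻¹ * m) = n * (b * m) := by group
  rwa [P.mul_mul_cancel_of_mem_S hs, e] at h2

/-! ### The exchange condition and the longest element. -/

/-- The exchange condition. -/
theorem mem_S_mul_eq_mul_mem_S {s r v : P.W} (hs : s ∈ P.S) (hr : r ∈ P.S)
    (h1 : P.length v < P.length (s * v)) (h2 : P.length (s * (v * r)) < P.length (v * r)) :
    s * v = v * r := by
  obtain ⟨n, rfl⟩ := exists_coe_eq s
  obtain ⟨m, rfl⟩ := exists_coe_eq v
  obtain ⟨c, rfl⟩ := exists_coe_eq r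
  -- The element `n b m c` lies in the cell of `v r` by this choice of `b`, and in that of `s v r`
  -- or `s v` because `n b m ∈ B s v B`. Disjointness leaves only `s v = v r`.
  obtain ⟨b, hb, h⟩ := exists_mul_mem_bruhatCell_of_lt hs h2 n rfl (m * c) rfl
  have h3 := mul_mem_bruhatCell_of_le hs h1.le (coe_mem_bruhatCell n)
    (mul_mem_bruhatCell hb (coe_mem_bruhatCell m))
  have h4 := mem_bruhatCell_mul_or hr h3 (coe_mem_bruhatCell c)
  have e : (n : G) * (b * m) * c = n * (b * ((m * c : P.N) : G)) := by simp [mul_assoc]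
  rw [e] at h4
  rcases h4 with h4 | h4
  · have := eq_of_mem_bruhatCell h4 h
    rw [mul_assoc] at this
    exact absurd (mul_eq_right.1 this) (P.ne_one_of_mem_S hs)
  · exact eq_of_mem_bruhatCell h4 h

/-- The letter that `s` deletes from a reduced word for `v z` must lie in `z`, since `s` lengthens
`v`. The induction strips the last letter of `z` until the exchange condition identifies the deleted
one. -/
theorem length_conj_mul_lt (m : ℕ) : ∀ {s v z : P.W}, s ∈ P.S → P.length z = m →
    P.length (v * z) = P.length v + P.length z → P.length v < P.length (s * v) →
    P.length (s * (v * z)) < P.length (v * z) → P.length (v⁻¹ * (s * (v * z))) < P.length z := by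
  induction m with
  | zero =>
    intro s v z hs hz hvz h1 h2
    obtain rfl := P.eq_one_of_length_eq_zero hz
    simp only [mul_one] at h2
    omega
  | succ m ih =>
    intro s v z hs hz hvz h1 h2
    obtain ⟨r, hr, z, rfl, hl⟩ := P.exists_eq_mul_mem_S (w := z) (by omega)
    have h3 := P.length_mul_le v z
    have h4 := P.length_mul_mem_S_le hr (v * z)
    rw [mul_assoc] at h4
    rcases length_mem_S_mul hs (v * z) with h5 | h5
    · have := mem_S_mul_eq_mul_mem_S (v := v * z) hs hr (by omega) (by rwa [mul_assoc v z r])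
      have e : v⁻¹ * (s * (v * (z * r))) = z := by
        rw [← mul_assoc v z r, ← mul_assoc s, this, P.mul_mul_cancel_right_of_mem_S hr,
          inv_mul_cancel_left]
      rw [e]
      omega
    · have h6 := ih (z := z) hs (by omega) (by omega) h1 (by omega)
      have h7 := P.length_mul_mem_S_le hr (v⁻¹ * (s * (v * z)))
      simp only [mul_assoc] at h7 h6 ⊢
      omega

variable (P)

/-- `w₀` has maximal length in `W`. -/
def IsLongest (w₀ : P.W) : Prop := ∀ w, P.length w ≤ P.length w₀

theorem exists_isLongest [Finite P.W] : ∃ w₀, P.IsLongest w₀ :=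
  Finite.exists_max P.length

variable {P}

theorem IsLongest.length_mem_S_mul {w₀ : P.W} (h₀ : P.IsLongest w₀) {s : P.W} (hs : s ∈ P.S) :
    P.length (s * w₀) + 1 = P.length w₀ := by
  have := h₀ (s * w₀)
  rcases BNPair.length_mem_S_mul hs w₀ with h | h <;> omega

/-- Every `w` begins a reduced word for `w₀`. If this holds for `v` and `s` lengthens `v`, then, as
`s` shortens `w₀ = v (v⁻¹ w₀)`, the previous lemma shortens `v⁻¹ w₀`, and the triangle inequality
gives equality for `s v`. -/
theorem IsLongest.length_add {w₀ : P.W} (h₀ : P.IsLongest w₀) (w : P.W) :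
    P.length w + P.length (w⁻¹ * w₀) = P.length w₀ := by
  induction hm : P.length w generalizing w with
  | zero =>
    obtain rfl := P.eq_one_of_length_eq_zero hm
    simp
  | succ m ih =>
    obtain ⟨s, hs, v, rfl, hl⟩ := P.exists_eq_mem_S_mul (w := w) (by omega)
    have h1 := ih v (by omega)
    have h2 := length_conj_mul_lt _ (s := s) (v := v) (z := v⁻¹ * w₀) hs rfl
      (by rw [mul_inv_cancel_left]; omega) (by omega)
      (by rw [mul_inv_cancel_left]; have := h₀.length_mem_S_mul hs; omega)
    rw [mul_inv_cancel_left, ← mul_assoc] at h2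
    have h3 : (s * v)⁻¹ * w₀ = v⁻¹ * s * w₀ := by rw [mul_inv_rev, P.inv_of_mem_S hs]
    have h4 := P.length_mul_le (s * v) ((s * v)⁻¹ * w₀)
    rw [mul_inv_cancel_left] at h4
    rw [h3] at h4 ⊢
    omega

/-- An element fixing the chambers `B` and `a c B` fixes each chamber of a minimal gallery between
them, in particular `a B`. In the induction, a failure at the last step `s` would put an element of
`B s c B` in `B c B`. -/
theorem conj_mem_of_length_add (m : ℕ) : ∀ (a c : P.N) (x : G),
    P.length (QuotientGroup.mk a) = m →
    P.length (QuotientGroup.mk (a * c)) =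
      P.length (QuotientGroup.mk a) + P.length (QuotientGroup.mk c) →
    x ∈ P.B → ((a : G) * c)⁻¹ * x * (a * c) ∈ P.B → (a : G)⁻¹ * x * a ∈ P.B := by
  induction m with
  | zero =>
    intro a c x ha _ hx _
    have h1 := P.eq_one_of_length_eq_zero ha
    have h2 := coe_mem_bruhatCell a
    rw [h1, mem_bruhatCell_one] at h2
    exact P.B.mul_mem (P.B.mul_mem (P.B.inv_mem h2) hx) h2
  | succ m ih =>
    intro a c x ha hl hx hxac
    obtain ⟨s, hs, v, hv, hl'⟩ := P.exists_eq_mul_mem_S (w := QuotientGroup.mk a) (by omega)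
    obtain ⟨n, rfl⟩ := exists_coe_eq s
    obtain ⟨d, hd⟩ : ∃ d : P.N, a = d * n := ⟨a * n⁻¹, by group⟩
    subst hd
    have hvd : v = QuotientGroup.mk d := by
      rw [QuotientGroup.mk_mul] at hv
      exact (mul_right_cancel hv).symm
    subst hvd
    have h1 := P.length_mul_le (QuotientGroup.mk d) (QuotientGroup.mk (n * c))
    have h2 := P.length_mem_S_mul_le hs (QuotientGroup.mk c)
    rw [← QuotientGroup.mk_mul] at h1 h2
    rw [← mul_assoc] at h1
    have hy := ih d (n * c) x (by omega) (by rw [← mul_assoc]; omega) hx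
      (by simpa [mul_assoc] using hxac)
    set y := (d : G)⁻¹ * x * d with hy_def
    have e1 : ((d * n : P.N) : G)⁻¹ * x * (d * n : P.N) = (n : G)⁻¹ * y * n := by
      simp [hy_def, mul_assoc]
    have e2 : (((d * n : P.N) : G) * c)⁻¹ * x * ((d * n : P.N) * c) =
        (c : G)⁻¹ * ((n : G)⁻¹ * y * n) * c := by
      simp [hy_def, mul_assoc]
    rw [e1]
    rw [e2] at hxac
    have hn := inv_mem_bruhatCell (coe_mem_bruhatCell n)
    rw [P.inv_of_mem_S hs] at hn
    have h3 := mul_mem_bruhatCell_or hs (mem_bruhatCell_mul hn hy) (coe_mem_bruhatCell n)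
    rw [P.mul_self_of_mem_S hs, mem_bruhatCell_one] at h3
    refine h3.resolve_right fun h3 => ?_
    have h4 := mul_mem_bruhatCell_of_le (w := QuotientGroup.mk c) hs
      (by rw [← QuotientGroup.mk_mul]; omega) h3 (coe_mem_bruhatCell c)
    have h5 := mem_bruhatCell_mul (coe_mem_bruhatCell c) hxac
    have e3 : (c : G) * ((c : G)⁻¹ * ((n : G)⁻¹ * y * n) * c) = (n : G)⁻¹ * y * n * c := by group
    rw [e3] at h5
    exact P.ne_one_of_mem_S hs (mul_eq_right.1 (eq_of_mem_bruhatCell h4 h5))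

end BNPair

/-! ### Rank one computations next to the longest element. -/

namespace BNPair

variable {G : Type*} [Group G] {P : BNPair G}

theorem conj_mem_T (c : P.N) {t : G} (ht : t ∈ P.T) : (c : G)⁻¹ * t * c ∈ P.T := by
  have := P.normal_T.conj_mem ⟨t, ht.2⟩ (Subgroup.mem_subgroupOf.2 ht) c⁻¹
  rw [Subgroup.mem_subgroupOf] at this
  simpa using this

theorem mul_mem_B_or_bruhatCell {s : P.W} (hs : s ∈ P.S) {g h : G} (hg : g ∈ P.bruhatCell s)
    (hh : h ∈ P.bruhatCell s) : g * h ∈ P.B ∨ g * h ∈ P.bruhatCell s := by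
  have := mul_mem_bruhatCell_or hs hg hh
  rwa [P.mul_self_of_mem_S hs, mem_bruhatCell_one] at this

theorem inv_mem_bruhatCell_of_mem_S {s : P.W} (hs : s ∈ P.S) {g : G} (hg : g ∈ P.bruhatCell s) :
    g⁻¹ ∈ P.bruhatCell s := by
  simpa [P.inv_of_mem_S hs] using inv_mem_bruhatCell hg

section Longest

variable {n a : P.N} (hn : (QuotientGroup.mk n : P.W) ∈ P.S)
  (h₀ : P.IsLongest (QuotientGroup.mk (n * a)))

include hn h₀

theorem IsLongest.length_lt :
    P.length (QuotientGroup.mk a) < P.length (QuotientGroup.mk n * QuotientGroup.mk a) := by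
  have := h₀.length_mem_S_mul hn
  rw [QuotientGroup.mk_mul, P.mul_mul_cancel_of_mem_S hn] at this
  omega

/-- An element of `B` fixing the chamber of `s w₀` fixes the chambers of all `w` with
`l(s w) > l(w)`. -/
theorem IsLongest.conj_mem_of_conj_mem {y : G} (hy : y ∈ P.B) (hya : (a : G)⁻¹ * y * a ∈ P.B)
    (c : P.N) (hc : P.length (QuotientGroup.mk c) <
      P.length (QuotientGroup.mk n * QuotientGroup.mk c)) : (c : G)⁻¹ * y * c ∈ P.B := by
  refine conj_mem_of_length_add _ c (c⁻¹ * a) y rfl ?_ hy (by simpa using hya)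
  have h1 := h₀.length_mem_S_mul hn
  have h2 := h₀.length_add (QuotientGroup.mk n * QuotientGroup.mk c)
  rw [QuotientGroup.mk_mul, P.mul_mul_cancel_of_mem_S hn] at h1
  rw [QuotientGroup.mk_mul, mul_inv_rev, mul_assoc, inv_mul_cancel_left] at h2
  rw [mul_inv_cancel_left, QuotientGroup.mk_mul, QuotientGroup.mk_inv]
  rcases BNPair.length_mem_S_mul hn (QuotientGroup.mk c) with h | h <;> omega

theorem IsLongest.mem_B_of_mul_mem {g : G} (hg : g ∈ P.B ∨ g ∈ P.bruhatCell (QuotientGroup.mk n))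
    (hga : g * a ∈ P.bruhatCell (QuotientGroup.mk a)) : g ∈ P.B := by
  refine hg.resolve_right fun h => ?_
  have h1 := mul_mem_bruhatCell_of_le hn (h₀.length_lt hn).le h (coe_mem_bruhatCell a)
  exact P.ne_one_of_mem_S hn (mul_eq_right.1 (eq_of_mem_bruhatCell h1 hga))

/-- `B = (B ∩ s B s⁻¹) (B ∩ v B v⁻¹)` for `v = s w₀`. -/
theorem IsLongest.exists_eq_mul {b : G} (hb : b ∈ P.B) :
    ∃ c ∈ P.B, ∃ y ∈ P.B, (n : G) * c * (n : G)⁻¹ ∈ P.B ∧ (a : G)⁻¹ * y * a ∈ P.B ∧ b = c * y := by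
  have h1 := mul_mem_bruhatCell_of_le hn (h₀.length_lt hn).le (coe_mem_bruhatCell n)
    (mul_mem_bruhatCell hb (coe_mem_bruhatCell a))
  rw [← QuotientGroup.mk_mul] at h1
  obtain ⟨u, hu, b', hb', e⟩ := exists_of_mem_bruhatCell _ h1
  rw [Subgroup.coe_mul] at e
  have hs := coe_mem_bruhatCell n
  have hc : (n : G)⁻¹ * u * n ∈ P.B := by
    refine h₀.mem_B_of_mul_mem hn (mul_mem_B_or_bruhatCell hn
      (mem_bruhatCell_mul (inv_mem_bruhatCell_of_mem_S hn hs) hu) hs) ?_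
    have e' : (n : G)⁻¹ * u * n * a = b * a * b'⁻¹ := by
      rw [eq_mul_inv_iff_mul_eq, ← mul_right_inj (n : G), e]
      group
    rw [e']
    exact mem_bruhatCell_mul (mul_mem_bruhatCell hb (coe_mem_bruhatCell a)) (P.B.inv_mem hb')
  have e' : ((n : G)⁻¹ * u * n)⁻¹ * b = a * b' * (a : G)⁻¹ := by
    have eb : b = (n : G)⁻¹ * (u * (n * a) * b') * (a : G)⁻¹ := by
      rw [← e]
      group
    rw [eb]
    group
  refine ⟨(n : G)⁻¹ * u * n, hc, ((n : G)⁻¹ * u * n)⁻¹ * b, P.B.mul_mem (P.B.inv_mem hc) hb,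
    ?_, ?_, by group⟩
  · simpa [mul_assoc] using hu
  · rw [e']
    simpa [mul_assoc] using hb'

/-- The rank one computation: if `y` fixes the chamber of `v = s w₀` and `s y s ∉ B`, then
`s y s = u s z` where `u` and `z` fix that chamber as well. -/
theorem IsLongest.exists_mul_mul_eq {y : G} (hy : y ∈ P.B) (hya : (a : G)⁻¹ * y * a ∈ P.B)
    (hny : (n : G) * y * n ∉ P.B) :
    ∃ u ∈ P.B, ∃ z ∈ P.B, (a : G)⁻¹ * u * a ∈ P.B ∧ (a : G)⁻¹ * z * a ∈ P.B ∧
      (n : G) * y * n = u * n * z := by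
  have hs := coe_mem_bruhatCell n
  have hg := (mul_mem_B_or_bruhatCell hn (mem_bruhatCell_mul hs hy) hs).resolve_left hny
  have h1 := mul_mem_bruhatCell_of_le hn (h₀.length_lt hn).le hg (coe_mem_bruhatCell a)
  rw [← QuotientGroup.mk_mul] at h1
  obtain ⟨u, hu, b, hb, e⟩ := exists_of_mem_bruhatCell _ h1
  rw [Subgroup.coe_mul] at e
  have e1 : (n : G) * y * n = u * n * (a * b * (a : G)⁻¹) := by
    rw [← mul_left_inj (a : G), e]
    group
  have hz : (a : G) * b * (a : G)⁻¹ ∈ P.B := by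
    refine h₀.mem_B_of_mul_mem hn ?_ ?_
    · have e2 : (a : G) * b * (a : G)⁻¹ = (n : G)⁻¹ * (u⁻¹ * (n * y * n)) := by
        rw [e1]
        group
      rw [e2]
      exact mul_mem_B_or_bruhatCell hn (inv_mem_bruhatCell_of_mem_S hn hs)
        (mul_mem_bruhatCell (P.B.inv_mem hu) hg)
    · simpa using mem_bruhatCell_mul (coe_mem_bruhatCell a) hb
  refine ⟨u, hu, _, hz, ?_, by simpa [mul_assoc] using hb, e1⟩
  -- Conjugation by `a` carries `s` to another element of `S`, because `a d` is longest and exactly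
  -- one longer than `a`. This allows the argument to be repeated on the right of `a`.
  obtain ⟨d, hd⟩ : ∃ d : P.N, n * a = a * d := ⟨a⁻¹ * (n * a), by group⟩
  have hd' : (n : G) * a = a * d := congrArg Subtype.val hd
  have hlt := h₀.length_lt hn
  have hmk : (QuotientGroup.mk n * QuotientGroup.mk a : P.W) =
    QuotientGroup.mk a * QuotientGroup.mk d := by
    rw [← QuotientGroup.mk_mul, hd, QuotientGroup.mk_mul]
  have hdS : (QuotientGroup.mk d : P.W) ∈ P.S := by
    apply P.mem_S_of_length_eq_one
    have h2 := h₀.length_add (QuotientGroup.mk a)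
    have h3 := h₀.length_mem_S_mul hn
    rw [QuotientGroup.mk_mul, P.mul_mul_cancel_of_mem_S hn] at h3
    rw [QuotientGroup.mk_mul] at h2
    rw [hmk] at h2 h3
    rw [inv_mul_cancel_left] at h2
    omega
  have hcd := coe_mem_bruhatCell d
  have e3 : (a : G)⁻¹ * u * a = d * ((a : G)⁻¹ * y * a) * d * (b⁻¹ * (d : G)⁻¹) := by
    have en : (n : G) = a * d * (a : G)⁻¹ := by
      rw [← hd']
      group
    have eu : u = n * y * n * a * b⁻¹ * ((n : G) * a)⁻¹ := by
      rw [e]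
      group
    rw [eu, en]
    group
  have h4 : (a : G)⁻¹ * u * a ∈ P.B ∨ (a : G)⁻¹ * u * a ∈ P.bruhatCell (QuotientGroup.mk d) := by
    have h5 := mul_mem_bruhatCell (P.B.inv_mem hb) (inv_mem_bruhatCell_of_mem_S hdS hcd)
    rw [e3]
    rcases mul_mem_B_or_bruhatCell hdS (mem_bruhatCell_mul hcd hya) hcd with h | h
    · exact Or.inr (mul_mem_bruhatCell h h5)
    · exact mul_mem_B_or_bruhatCell hdS h h5
  -- If `a⁻¹ u a` were in `B d B`, then `u a` would lie in `B a d B`, although `u ∈ B`.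
  refine h4.resolve_right fun h4 => ?_
  rw [hmk] at hlt
  have h5 := mem_bruhatCell_mul_of_le hdS hlt.le (coe_mem_bruhatCell a) h4
  have e4 : (a : G) * ((a : G)⁻¹ * u * a) = u * a := by group
  rw [e4] at h5
  have := eq_of_mem_bruhatCell h5 (mul_mem_bruhatCell hu (coe_mem_bruhatCell a))
  exact P.ne_one_of_mem_S hdS (mul_eq_left.1 this)

end Longest

end BNPair

/-! ### Maps out of induced representations. -/

namespace Representation.IndV

variable {k : Type*} [Field k] {V : Type*} [AddCommGroup V] [Module k V] {X : Type*}
  [AddCommGroup X] [Module k X] {H K : Type*} [Group H] [Group K] (φ : K →* H)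
  (ρ : Representation k K V)

/-- In this model `mk h v` plays the role of `h⁻¹ ⊗ v`, which accounts for the inverses in all later
formulas. -/
theorem mk_mul (c : K) (h : H) (v : V) : mk φ ρ (φ c * h) (ρ c v) = mk φ ρ h v := by
  have := Coinvariants.mk_self_apply (tprod ((leftRegular k H).comp φ) ρ) c
    (MonoidAlgebra.single h 1 ⊗ₜ[k] v)
  simpa using this

/-- A linear map out of an induced representation, from a compatible family of linear maps. -/
noncomputable def lift (f : H → V →ₗ[k] X) (hf : ∀ c h, f (φ c * h) ∘ₗ ρ c = f h) :
    IndV φ ρ →ₗ[k] X :=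
  Coinvariants.lift _ (TensorProduct.lift ((Finsupp.linearCombination k f) ∘ₗ
    (MonoidAlgebra.coeffLinearEquiv k).toLinearMap)) fun c => by
      ext h v
      simpa using LinearMap.congr_fun (hf c h) v

theorem lift_mk (f : H → V →ₗ[k] X) (hf : ∀ c h, f (φ c * h) ∘ₗ ρ c = f h) (h : H) (v : V) :
    lift φ ρ f hf (mk φ ρ h v) = f h v := by
  simp [lift]

end Representation.IndV

/-! ### Stability of `k U η` under `G`. -/

namespace SplitBNPair

variable {G : Type*} [Group G] (P : SplitBNPair G)

theorem mem_U_of_proj_eq_one {b : P.B} (h : P.proj b = 1) : (b : G) ∈ P.U := by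
  simp only [proj, MonoidHom.comp_apply, MulEquiv.coe_toMonoidHom, map_eq_one_iff _
    (MulEquiv.injective _)] at h
  exact Subgroup.mem_subgroupOf.1 ((QuotientGroup.eq_one_iff b).1 h)

theorem mul_inv_proj_mem_U (b : P.B) : (b : G) * ((P.proj b : P.T) : G)⁻¹ ∈ P.U := by
  have h : P.proj (b * (⟨P.proj b, P.T_le_B (P.proj b).2⟩ : P.B)⁻¹) = 1 := by
    rw [map_mul, map_inv, P.proj_of_mem_T ⟨_, P.T_le_B (P.proj b).2⟩ (P.proj b).2]
    exact mul_inv_cancel _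
  exact P.mem_U_of_proj_eq_one h

variable (k : Type*) [Field k]

theorem M_tr_oneTr_of_mem_B {b : G} (hb : b ∈ P.B) : P.M (P.tr k) b (P.oneTr k) = P.oneTr k := by
  rw [oneTr, M, M.one, Representation.ind_mk]
  simpa using Representation.IndV.mk_mul P.B.subtype ((P.tr k).comp P.proj) ⟨b, hb⟩⁻¹ 1 1

theorem M_tr_mul_apply (g h : G) (x : P.MSpace (P.tr k)) :
    P.M (P.tr k) (g * h) x = P.M (P.tr k) g (P.M (P.tr k) h x) := by
  rw [map_mul, Module.End.mul_apply]

theorem M_tr_weylTr_mul (n : P.N) (w : P.W) :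
    P.M (P.tr k) n (P.weylTr k w) = P.weylTr k (QuotientGroup.mk n * w) := by
  obtain ⟨m, rfl⟩ := BNPair.exists_coe_eq w
  change P.M (P.tr k) n (P.M (P.tr k) m (P.oneTr k)) =
    P.M (P.tr k) ((n * m : P.N) : G) (P.oneTr k)
  rw [Subgroup.coe_mul, map_mul, Module.End.mul_apply]

theorem M_tr_weylTr_of_conj_mem {y : G} (c : P.N) (h : (c : G)⁻¹ * y * c ∈ P.B) :
    P.M (P.tr k) y (P.weylTr k (QuotientGroup.mk c)) = P.weylTr k (QuotientGroup.mk c) := by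
  change P.M (P.tr k) y (P.M (P.tr k) c (P.oneTr k)) = P.M (P.tr k) c (P.oneTr k)
  conv_rhs => rw [← P.M_tr_oneTr_of_mem_B k h]
  rw [← Module.End.mul_apply, ← map_mul, ← Module.End.mul_apply, ← map_mul]
  congr 2
  group

theorem M_tr_weylTr_of_mem_T {t : G} (ht : t ∈ P.T) (w : P.W) :
    P.M (P.tr k) t (P.weylTr k w) = P.weylTr k w := by
  obtain ⟨m, rfl⟩ := BNPair.exists_coe_eq w
  exact P.M_tr_weylTr_of_conj_mem k m (BNPair.conj_mem_T m ht).1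

variable [Fintype P.W]

theorem M_tr_eta_of_mem_T {t : G} (ht : t ∈ P.T) : P.M (P.tr k) t (P.eta k) = P.eta k := by
  simp only [eta, map_sum, map_smul, P.M_tr_weylTr_of_mem_T k ht]

open Classical in
/-- The half of the alternating sum `η` over the `w` with `l(s w) > l(w)`. -/
noncomputable def halfEta (s : P.W) : P.MSpace (P.tr k) :=
  ∑ w : P.W with P.length w < P.length (s * w), (-1 : k) ^ P.length w • P.weylTr k w

/-- Left multiplication by `s` exchanges the two halves of `W` and changes the sign. -/
theorem eta_eq_sub {n : P.N} (hn : (QuotientGroup.mk n : P.W) ∈ P.S) :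
    P.eta k = P.halfEta k (QuotientGroup.mk n) -
      P.M (P.tr k) n (P.halfEta k (QuotientGroup.mk n)) := by
  classical
  rw [eta, halfEta, ← Finset.sum_filter_add_sum_filter_not Finset.univ
    (fun w => P.length w < P.length (QuotientGroup.mk n * w)), sub_eq_add_neg, map_sum,
    ← Finset.sum_neg_distrib]
  congr 1
  refine (Finset.sum_nbij' (fun w => QuotientGroup.mk n * w) (fun w => QuotientGroup.mk n * w)
    ?_ ?_ ?_ ?_ ?_).symm
  · intro w hw
    simp only [Finset.mem_filter, Finset.mem_univ, true_and] at hw ⊢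
    rw [P.mul_mul_cancel_of_mem_S hn]
    omega
  · intro w hw
    simp only [Finset.mem_filter, Finset.mem_univ, true_and] at hw ⊢
    rw [P.mul_mul_cancel_of_mem_S hn]
    have := BNPair.length_mem_S_mul_ne hn w
    omega
  · intro w _
    exact P.mul_mul_cancel_of_mem_S hn w
  · intro w _
    exact P.mul_mul_cancel_of_mem_S hn w
  · intro w hw
    simp only [Finset.mem_filter, Finset.mem_univ, true_and] at hw
    rcases BNPair.length_mem_S_mul hn w with h | h
    · rw [h, map_smul, P.M_tr_weylTr_mul, pow_succ]
      simp
    · omega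

theorem M_tr_halfEta_of_mem_T {t : G} (ht : t ∈ P.T) (s : P.W) :
    P.M (P.tr k) t (P.halfEta k s) = P.halfEta k s := by
  simp only [halfEta, map_sum, map_smul, P.M_tr_weylTr_of_mem_T k ht]

theorem M_tr_halfEta_of_conj_mem {n a : P.N} (hn : (QuotientGroup.mk n : P.W) ∈ P.S)
    (h₀ : P.IsLongest (QuotientGroup.mk (n * a))) {y : G} (hy : y ∈ P.B)
    (hya : (a : G)⁻¹ * y * a ∈ P.B) :
    P.M (P.tr k) y (P.halfEta k (QuotientGroup.mk n)) = P.halfEta k (QuotientGroup.mk n) := by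
  rw [halfEta, map_sum]
  refine Finset.sum_congr rfl fun w hw => ?_
  simp only [Finset.mem_filter, Finset.mem_univ, true_and] at hw
  obtain ⟨c, rfl⟩ := BNPair.exists_coe_eq w
  rw [map_smul, P.M_tr_weylTr_of_conj_mem k c (h₀.conj_mem_of_conj_mem hn hy hya c hw)]

theorem M_tr_eta_of_mem_S {n : P.N} (hn : (QuotientGroup.mk n : P.W) ∈ P.S) :
    P.M (P.tr k) n (P.eta k) = - P.eta k := by
  rw [P.eta_eq_sub k hn, map_sub, ← M_tr_mul_apply,
    P.M_tr_halfEta_of_mem_T k (BNPair.mul_self_mem_T hn), neg_sub]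

theorem M_tr_eta_mem {b : G} (hb : b ∈ P.B) : P.M (P.tr k) b (P.eta k) ∈ P.steinbergSpace k := by
  have h := P.mul_inv_proj_mem_U ⟨b, hb⟩
  refine Submodule.subset_span ⟨⟨_, h⟩, ?_⟩
  simp only [M_tr_mul_apply]
  rw [P.M_tr_eta_of_mem_T k (P.T.inv_mem (P.proj ⟨b, hb⟩).2)]

theorem M_tr_mem_of_forall {g : G}
    (hg : ∀ b ∈ P.B, P.M (P.tr k) (g * b) (P.eta k) ∈ P.steinbergSpace k)
    {x : P.MSpace (P.tr k)} (hx : x ∈ P.steinbergSpace k) :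
    P.M (P.tr k) g x ∈ P.steinbergSpace k := by
  suffices P.steinbergSpace k ≤ (P.steinbergSpace k).comap (P.M (P.tr k) g) from this hx
  rw [steinbergSpace, Submodule.span_le]
  rintro _ ⟨u, rfl⟩
  have := hg u (P.U_le u.2)
  rwa [M_tr_mul_apply] at this

theorem M_tr_mem_of_mem_B {b : G} (hb : b ∈ P.B) {x : P.MSpace (P.tr k)}
    (hx : x ∈ P.steinbergSpace k) : P.M (P.tr k) b x ∈ P.steinbergSpace k :=
  P.M_tr_mem_of_forall k (fun _ hc => P.M_tr_eta_mem k (P.B.mul_mem hb hc)) hx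

theorem M_tr_mem_of_mem_S {n : P.N} (hn : (QuotientGroup.mk n : P.W) ∈ P.S)
    {x : P.MSpace (P.tr k)} (hx : x ∈ P.steinbergSpace k) :
    P.M (P.tr k) n x ∈ P.steinbergSpace k := by
  refine P.M_tr_mem_of_forall k (fun b hb => ?_) hx
  obtain ⟨w₀, h₀⟩ := P.exists_isLongest
  obtain ⟨m, rfl⟩ := BNPair.exists_coe_eq w₀
  obtain ⟨a, rfl⟩ : ∃ a, m = n * a := ⟨n⁻¹ * m, by group⟩
  obtain ⟨c, hc, y, hy, hnc, hya, rfl⟩ := h₀.exists_eq_mul hn hb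
  -- Since `n c n⁻¹ ∈ B` preserves `k U η`, only `n y η` matters.
  have e : (n : G) * (c * y) = (n * c * (n : G)⁻¹) * (n * y) := by group
  rw [e, M_tr_mul_apply]
  refine P.M_tr_mem_of_mem_B k hnc ?_
  by_cases hny : (n : G) * y * n ∈ P.B
  · have h : P.M (P.tr k) (n * y) (P.eta k) = - P.M (P.tr k) (n * y * n) (P.eta k) := by
      rw [M_tr_mul_apply P k (n * y) n, P.M_tr_eta_of_mem_S k hn, map_neg, neg_neg]
    rw [h]
    exact Submodule.neg_mem _ (P.M_tr_eta_mem k hny)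
  · obtain ⟨u, hu, z, hz, hua, hza, e'⟩ := h₀.exists_mul_mul_eq hn hy hya hny
    -- With `η = h - n h`, and `y`, `z`, `u` all fixing `h`, both sides equal `n h - u n h`.
    have h : P.M (P.tr k) (n * y) (P.eta k) = P.M (P.tr k) u (P.eta k) - P.eta k := by
      rw [P.eta_eq_sub k hn, map_sub, ← M_tr_mul_apply, e', map_sub, ← M_tr_mul_apply,
        M_tr_mul_apply P k n y, M_tr_mul_apply P k (u * n) z,
        P.M_tr_halfEta_of_conj_mem k hn h₀ hy hya, P.M_tr_halfEta_of_conj_mem k hn h₀ hz hza,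
        P.M_tr_halfEta_of_conj_mem k hn h₀ hu hua]
      abel
    rw [h]
    exact Submodule.sub_mem _ (P.M_tr_eta_mem k hu) (P.eta_mem k)

/-- The subgroup of `G` stabilizing `k U η`. -/
noncomputable def steinbergStabilizer : Subgroup G where
  carrier := {g | ∀ x, P.M (P.tr k) g x ∈ P.steinbergSpace k ↔ x ∈ P.steinbergSpace k}
  one_mem' x := by simp only [map_one, Module.End.one_apply]
  mul_mem' {g h} hg hh x := by rw [M_tr_mul_apply, hg, hh]
  inv_mem' {g} hg x := by
    rw [← hg, ← M_tr_mul_apply, mul_inv_cancel, map_one, Module.End.one_apply]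

theorem mem_steinbergStabilizer {g : G}
    (h : ∀ x ∈ P.steinbergSpace k, P.M (P.tr k) g x ∈ P.steinbergSpace k)
    (h' : ∀ x ∈ P.steinbergSpace k, P.M (P.tr k) g⁻¹ x ∈ P.steinbergSpace k) :
    g ∈ P.steinbergStabilizer k := fun x =>
  ⟨fun hx => by
    simpa only [← M_tr_mul_apply, inv_mul_cancel, map_one, Module.End.one_apply] using h' _ hx, h x⟩

theorem B_le_steinbergStabilizer : P.B ≤ P.steinbergStabilizer k := fun _ hb =>
  P.mem_steinbergStabilizer k (fun _ => P.M_tr_mem_of_mem_B k hb)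
    (fun _ => P.M_tr_mem_of_mem_B k (P.B.inv_mem hb))

theorem N_le_steinbergStabilizer : P.N ≤ P.steinbergStabilizer k := by
  intro g hg
  have htop : ((P.steinbergStabilizer k).subgroupOf P.N).map
      (QuotientGroup.mk' (P.T.subgroupOf P.N)) = ⊤ := by
    rw [eq_top_iff, ← P.closure_S, Subgroup.closure_le]
    intro s hs
    obtain ⟨n, rfl⟩ := BNPair.exists_coe_eq s
    refine ⟨n, Subgroup.mem_subgroupOf.2 (P.mem_steinbergStabilizer k
      (fun _ => P.M_tr_mem_of_mem_S k hs) (fun _ => ?_)), rfl⟩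
    refine P.M_tr_mem_of_mem_S k (n := n⁻¹) ?_
    rwa [QuotientGroup.mk_inv, P.inv_of_mem_S hs]
  obtain ⟨m, hm, h⟩ : (QuotientGroup.mk ⟨g, hg⟩ : P.W) ∈
      ((P.steinbergStabilizer k).subgroupOf P.N).map
        (QuotientGroup.mk' (P.T.subgroupOf P.N)) := by
    rw [htop]
    trivial
  have ht := P.B_le_steinbergStabilizer k (BNPair.mk_eq_iff.1 h).1
  simpa using (P.steinbergStabilizer k).mul_mem (Subgroup.mem_subgroupOf.1 hm) ht

/-- `k U η` is a `G`-submodule of `M(tr)`. -/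
theorem M_tr_mem_steinbergSpace (g : G) {x : P.MSpace (P.tr k)} (hx : x ∈ P.steinbergSpace k) :
    P.M (P.tr k) g x ∈ P.steinbergSpace k := by
  have htop : P.steinbergStabilizer k = ⊤ := by
    rw [eq_top_iff, ← P.closure_union, Subgroup.closure_le, Set.union_subset_iff]
    exact ⟨P.B_le_steinbergStabilizer k, P.N_le_steinbergStabilizer k⟩
  have hg : g ∈ P.steinbergStabilizer k := htop ▸ Subgroup.mem_top g
  exact (hg x).2 hx

end SplitBNPair

/-! ### Linear independence of the elements `u η`. -/

namespace SplitBNPair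

variable {G : Type*} [Group G] (P : SplitBNPair G)

/-- Every `c` lies on a minimal gallery from `1` to `w₀`, so `x` lies in every `c B c⁻¹`, and the
splitting axiom identifies their intersection. -/
theorem mem_T_of_conj_mem {m : P.N} (h₀ : P.IsLongest (QuotientGroup.mk m)) {x : G} (hx : x ∈ P.B)
    (hxm : (m : G)⁻¹ * x * m ∈ P.B) : x ∈ P.T := by
  change x ∈ P.B ⊓ P.N
  rw [← P.iInf_conj, Subgroup.mem_iInf]
  intro c
  rw [Subgroup.mem_map_equiv]
  have := BNPair.conj_mem_of_length_add _ c (c⁻¹ * m) x rfl (by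
    have := h₀.length_add (QuotientGroup.mk c)
    rw [mul_inv_cancel_left]
    exact this.symm) hx (by simpa using hxm)
  simpa using this

theorem eq_of_mk_mul_eq {m c : P.N} (h₀ : P.IsLongest (QuotientGroup.mk m)) {u u' : P.U}
    (h : (QuotientGroup.mk ((u : G) * c) : G ⧸ P.B) = QuotientGroup.mk ((u' : G) * m)) :
    (QuotientGroup.mk c : P.W) = QuotientGroup.mk m ∧ u = u' := by
  rw [QuotientGroup.eq] at h
  have h1 := BNPair.mem_bruhatCell_mul
    (BNPair.mul_mem_bruhatCell (P.U_le u.2) (BNPair.coe_mem_bruhatCell c)) h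
  rw [mul_inv_cancel_left] at h1
  have h2 : (QuotientGroup.mk c : P.W) = QuotientGroup.mk m := BNPair.eq_of_mem_bruhatCell h1
    (BNPair.mul_mem_bruhatCell (P.U_le u'.2) (BNPair.coe_mem_bruhatCell m))
  refine ⟨h2, ?_⟩
  have h3 : (m : G)⁻¹ * ((u : G)⁻¹ * u') * m ∈ P.B := by
    have := P.B.mul_mem (BNPair.mk_eq_iff.1 h2.symm).1 h
    have e : (m : G)⁻¹ * c * (((u : G) * c)⁻¹ * (u' * m)) = (m : G)⁻¹ * ((u : G)⁻¹ * u') * m := by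
      group
    rwa [e] at this
  have h4 : (u : G)⁻¹ * u' ∈ P.U := P.U.mul_mem (P.U.inv_mem u.2) u'.2
  have h5 : (u : G)⁻¹ * u' ∈ P.U ⊓ (P.B ⊓ P.N) := ⟨h4, P.mem_T_of_conj_mem h₀ (P.U_le h4) h3⟩
  rw [P.U_inf_T, Subgroup.mem_bot, inv_mul_eq_one] at h5
  exact Subtype.ext h5

variable (k : Type*) [Field k]

/-- The identification of `M(tr)` with the permutation module on `G ⧸ B`. -/
noncomputable def toCosets : P.MSpace (P.tr k) →ₗ[k] (G ⧸ P.B →₀ k) :=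
  Representation.IndV.lift _ _ (fun g => Finsupp.lsingle (QuotientGroup.mk g⁻¹)) fun c h => by
    ext x
    have : (QuotientGroup.mk (((c : G) * h)⁻¹) : G ⧸ P.B) = QuotientGroup.mk h⁻¹ := by
      rw [mul_inv_rev, QuotientGroup.mk_mul_of_mem _ (P.B.inv_mem c.2)]
    simp only [Subgroup.subtype_apply, LinearMap.comp_apply, Finsupp.lsingle_apply, this,
      MonoidHom.comp_apply, Representation.isTrivial_def, LinearMap.id_apply]

theorem toCosets_oneTr (g : G) :
    P.toCosets k (P.M (P.tr k) g (P.oneTr k)) = Finsupp.single (QuotientGroup.mk g) 1 := by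
  rw [oneTr, M, M.one, Representation.ind_mk, toCosets, Representation.IndV.lift_mk]
  simp

theorem toCosets_weylTr (g : G) (c : P.N) :
    P.toCosets k (P.M (P.tr k) g (P.weylTr k (QuotientGroup.mk c))) =
      Finsupp.single (QuotientGroup.mk (g * c)) 1 := by
  rw [← toCosets_oneTr, M_tr_mul_apply]
  rfl

variable [Fintype P.W]

open Classical in
theorem toCosets_eta {m : P.N} (h₀ : P.IsLongest (QuotientGroup.mk m)) (u u' : P.U) :
    P.toCosets k (P.M (P.tr k) (u : G) (P.eta k)) (QuotientGroup.mk ((u' : G) * m)) =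
      if u = u' then (-1 : k) ^ P.length (QuotientGroup.mk m) else 0 := by
  simp only [eta, map_sum, map_smul, Finsupp.finsetSum_apply, Finsupp.smul_apply, smul_eq_mul]
  rw [Finset.sum_eq_single (QuotientGroup.mk m : P.W)]
  · rw [toCosets_weylTr, Finsupp.single_apply]
    by_cases h : u = u'
    · simp [h]
    · rw [if_neg h, if_neg fun h' => h (P.eq_of_mk_mul_eq h₀ h').2, mul_zero]
  · intro w _ hw
    obtain ⟨c, rfl⟩ := BNPair.exists_coe_eq w
    rw [toCosets_weylTr, Finsupp.single_apply,
      if_neg fun h' => hw (P.eq_of_mk_mul_eq h₀ h').1, mul_zero]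
  · simp

/-- The elements `u η`, `u ∈ U`, are linearly independent. -/
theorem linearIndependent_M_tr_eta :
    LinearIndependent k fun u : P.U => P.M (P.tr k) (u : G) (P.eta k) := by
  classical
  refine LinearIndependent.of_comp (P.toCosets k) (linearIndependent_iff'.2 fun s a h u hu => ?_)
  obtain ⟨w₀, h₀⟩ := P.exists_isLongest
  obtain ⟨m, rfl⟩ := BNPair.exists_coe_eq w₀
  -- The coefficient at `u w₀ B` sees only the term `u η`, with value `±1`.
  have h1 := DFunLike.congr_fun h (QuotientGroup.mk ((u : G) * m))
  simp only [Function.comp_apply, Finsupp.finsetSum_apply, Finsupp.smul_apply, smul_eq_mul,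
    P.toCosets_eta k h₀, Finsupp.zero_apply, mul_ite, mul_zero] at h1
  rw [Finset.sum_ite_eq' s u, if_pos hu] at h1
  exact (mul_eq_zero.1 h1).resolve_right (pow_ne_zero _ (neg_ne_zero.2 one_ne_zero))

/-- The basis of `k U η` consisting of the elements `u η`, `u ∈ U`. -/
noncomputable def steinbergBasis : Module.Basis P.U k (P.steinbergSpace k) :=
  Module.Basis.span (P.linearIndependent_M_tr_eta k)

/-- The element `η` of `k U η`. -/
noncomputable abbrev etaSt : P.steinbergSpace k := ⟨P.eta k, P.eta_mem k⟩

/-- The Steinberg module. -/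
noncomputable abbrev St : Representation k G (P.steinbergSpace k) :=
  P.steinberg k fun g _ hx => P.M_tr_mem_steinbergSpace k g hx

theorem steinbergBasis_apply (u : P.U) : P.steinbergBasis k u = P.St k u (P.etaSt k) :=
  Module.Basis.span_apply (P.linearIndependent_M_tr_eta k) u

theorem St_mul_apply (g h : G) (x : P.steinbergSpace k) :
    P.St k (g * h) x = P.St k g (P.St k h x) := by
  rw [map_mul, Module.End.mul_apply]

theorem St_etaSt_of_mem_T {t : G} (ht : t ∈ P.T) : P.St k t (P.etaSt k) = P.etaSt k :=
  Subtype.ext (P.M_tr_eta_of_mem_T k ht)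

theorem exists_St_steinbergBasis (c : P.B) (u : P.U) : ∃ u' : P.U,
    (u' : G) = c * u * ((P.proj c : P.T) : G)⁻¹ ∧
      P.St k c (P.steinbergBasis k u) = P.steinbergBasis k u' := by
  have h := P.mul_inv_proj_mem_U (c * ⟨u, P.U_le u.2⟩)
  rw [map_mul, P.proj_of_mem_U ⟨u, P.U_le u.2⟩ u.2, mul_one, Subgroup.coe_mul] at h
  refine ⟨⟨_, h⟩, rfl, ?_⟩
  rw [steinbergBasis_apply, steinbergBasis_apply, ← St_mul_apply, St_mul_apply _ _ (_ * _),
    P.St_etaSt_of_mem_T k (P.T.inv_mem (P.proj c).2)]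

/-! ### The isomorphism and its inverse. -/

variable {k} {V : Type*} [AddCommGroup V] [Module k V] (θ : Representation k P.T V)

/-- The map `Ind_T^G k_θ → M(θ) ⊗ St` sending `g 1_θ` to `g (1_θ ⊗ η)`. -/
noncomputable def indTToTensor :
    Representation.IndV P.T.subtype θ →ₗ[k] P.MSpace θ ⊗[k] P.steinbergSpace k :=
  Representation.IndV.lift _ _
    (fun g => (TensorProduct.mk k _ _).flip (P.St k g⁻¹ (P.etaSt k)) ∘ₗ
      Representation.IndV.mk P.B.subtype (θ.comp P.proj) g) fun t g => by
    ext v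
    have h := Representation.IndV.mk_mul P.B.subtype (θ.comp P.proj) ⟨t, P.T_le_B t.2⟩ g v
    rw [MonoidHom.comp_apply, P.proj_of_mem_T _ t.2] at h
    simp only [LinearMap.comp_apply, LinearMap.flip_apply, TensorProduct.mk_apply]
    rw [mul_inv_rev, St_mul_apply, Subgroup.subtype_apply,
      P.St_etaSt_of_mem_T k (P.T.inv_mem t.2)]
    exact congrArg (· ⊗ₜ[k] _) h

theorem indTToTensor_mk (g : G) (v : V) :
    P.indTToTensor θ (Representation.IndV.mk P.T.subtype θ g v) =
      Representation.IndV.mk P.B.subtype (θ.comp P.proj) g v ⊗ₜ[k] P.St k g⁻¹ (P.etaSt k) :=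
  Representation.IndV.lift_mk _ _ _ _ _ _

/-- The linear map `k U η → Hom(V, Ind_T^G k_θ)` sending `u η` to `v ↦ g⁻¹ u ⊗ v`. -/
noncomputable def steinbergToHom (g : G) :
    P.steinbergSpace k →ₗ[k] V →ₗ[k] Representation.IndV P.T.subtype θ :=
  (P.steinbergBasis k).constr k fun u =>
    Representation.IndV.mk P.T.subtype θ ((u : G)⁻¹ * g)

/-- The compatibility that lets the inverse descend to `M(θ)`: `c` sends `u η` to `c u t⁻¹ η`, where
`t` is the `T`-part of `c`, and `t` is absorbed by the relation defining `Ind_T^G`. -/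
theorem steinbergToHom_St (c : P.B) (g : G) (z : P.steinbergSpace k) (v : V) :
    P.steinbergToHom θ (c * g) (P.St k c z) (θ (P.proj c) v) = P.steinbergToHom θ g z v := by
  suffices h : (P.steinbergToHom θ (c * g) ∘ₗ P.St k c).compl₂ (θ (P.proj c)) =
      P.steinbergToHom θ g from LinearMap.congr_fun₂ h z v
  refine (P.steinbergBasis k).ext fun u => LinearMap.ext fun v => ?_
  obtain ⟨u', hu', h⟩ := P.exists_St_steinbergBasis k c u
  simp only [LinearMap.compl₂_apply, LinearMap.comp_apply, h]
  rw [steinbergToHom, steinbergToHom, Module.Basis.constr_basis, Module.Basis.constr_basis,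
    ← Representation.IndV.mk_mul P.T.subtype θ (P.proj c) ((u : G)⁻¹ * g) v, hu']
  congr 2
  simp [mul_assoc]

/-- The inverse of `indTToTensor`. -/
noncomputable def tensorToIndT :
    P.MSpace θ ⊗[k] P.steinbergSpace k →ₗ[k] Representation.IndV P.T.subtype θ :=
  TensorProduct.lift (Representation.IndV.lift _ _
    (fun g => (P.steinbergToHom θ g ∘ₗ P.St k g).flip) fun c g => by
      ext v z
      simp only [LinearMap.comp_apply, LinearMap.flip_apply, MonoidHom.comp_apply,
        Subgroup.subtype_apply]
      rw [St_mul_apply, steinbergToHom_St])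

theorem tensorToIndT_mk (g : G) (v : V) (z : P.steinbergSpace k) :
    P.tensorToIndT θ (Representation.IndV.mk P.B.subtype (θ.comp P.proj) g v ⊗ₜ[k] z) =
      P.steinbergToHom θ g (P.St k g z) v := by
  rw [tensorToIndT, TensorProduct.lift.tmul, Representation.IndV.lift_mk]
  rfl

theorem St_apply_inv (g : G) (z : P.steinbergSpace k) : P.St k g (P.St k g⁻¹ z) = z := by
  rw [← St_mul_apply, mul_inv_cancel, map_one, Module.End.one_apply]

theorem tensorToIndT_comp_indTToTensor :
    P.tensorToIndT θ ∘ₗ P.indTToTensor θ = LinearMap.id := by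
  refine Representation.IndV.hom_ext _ _ fun g => LinearMap.ext fun v => ?_
  have h : P.etaSt k = P.steinbergBasis k 1 := by
    rw [steinbergBasis_apply, Subgroup.coe_one, map_one, Module.End.one_apply]
  rw [LinearMap.comp_apply, LinearMap.comp_apply, indTToTensor_mk, tensorToIndT_mk, St_apply_inv,
    h, steinbergToHom, Module.Basis.constr_basis]
  simp only [Subgroup.coe_one, inv_one, one_mul, LinearMap.comp_apply, LinearMap.id_apply]

theorem indTToTensor_steinbergToHom (g : G) (z : P.steinbergSpace k) (v : V) :
    P.indTToTensor θ (P.steinbergToHom θ g z v) =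
      Representation.IndV.mk P.B.subtype (θ.comp P.proj) g v ⊗ₜ[k] P.St k g⁻¹ z := by
  suffices h : (P.steinbergToHom θ g).compr₂ (P.indTToTensor θ) =
      ((TensorProduct.mk k _ _).compl₁₂ (Representation.IndV.mk P.B.subtype (θ.comp P.proj) g)
        (P.St k g⁻¹)).flip from LinearMap.congr_fun₂ h z v
  refine (P.steinbergBasis k).ext fun u => LinearMap.ext fun v => ?_
  have h := Representation.IndV.mk_mul P.B.subtype (θ.comp P.proj) ⟨u, P.U_le u.2⟩⁻¹ g v
  rw [MonoidHom.comp_apply, P.proj_of_mem_U _ (P.U.inv_mem u.2), map_one,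
    Module.End.one_apply] at h
  rw [LinearMap.compr₂_apply, LinearMap.flip_apply, LinearMap.compl₁₂_apply, steinbergToHom,
    Module.Basis.constr_basis, indTToTensor_mk, steinbergBasis_apply, ← St_mul_apply,
    mul_inv_rev, inv_inv]
  exact congrArg (· ⊗ₜ[k] _) h

theorem indTToTensor_comp_tensorToIndT :
    P.indTToTensor θ ∘ₗ P.tensorToIndT θ = LinearMap.id := by
  refine TensorProduct.ext (Representation.IndV.hom_ext _ _ fun g => LinearMap.ext fun v =>
    LinearMap.ext fun z => ?_)
  change P.indTToTensor θ (P.tensorToIndT θ (Representation.IndV.mk _ _ g v ⊗ₜ[k] z)) =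
    Representation.IndV.mk _ _ g v ⊗ₜ[k] z
  rw [tensorToIndT_mk, indTToTensor_steinbergToHom, ← St_mul_apply, inv_mul_cancel, map_one,
    Module.End.one_apply]

theorem indTToTensor_comp_indT (g : G) :
    P.indTToTensor θ ∘ₗ P.indT θ g = (P.M θ).tprod (P.St k) g ∘ₗ P.indTToTensor θ := by
  refine Representation.IndV.hom_ext _ _ fun h => LinearMap.ext fun v => ?_
  change P.indTToTensor θ (P.indT θ g (Representation.IndV.mk _ _ h v)) =
    (P.M θ).tprod (P.St k) g (P.indTToTensor θ (Representation.IndV.mk _ _ h v))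
  rw [indT, Representation.ind_mk, indTToTensor_mk, indTToTensor_mk, Representation.tprod_apply,
    TensorProduct.map_tmul, M, Representation.ind_mk, mul_inv_rev, inv_inv, St_mul_apply]

end SplitBNPair

theorem proposition2p4 {G : Type*} [Group G] (P : SplitBNPair G) [Fintype P.W]
    {k : Type*} [Field k] {V : Type*} [AddCommGroup V] [Module k V]
    (hV : Module.finrank k V = 1) (θ : Representation k P.T V) :
    ∃ hSt : ∀ (g : G), ∀ x ∈ P.steinbergSpace k, P.M (P.tr k) g x ∈ P.steinbergSpace k,
      ∃ Φ : (P.indT θ).Equiv ((P.M θ).tprod (P.steinberg k hSt)),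
        ∀ (g : G) (v : V),
          Φ (P.indT θ g (SplitBNPair.indT.one P θ v)) =
            (P.M θ).tprod (P.steinberg k hSt) g
              (SplitBNPair.M.one P θ v ⊗ₜ[k] ⟨P.eta k, P.eta_mem k⟩) := by
  refine ⟨fun g _ hx => P.M_tr_mem_steinbergSpace k g hx, Representation.Equiv.mk
    (LinearEquiv.ofLinearMap (P.indTToTensor θ) (P.tensorToIndT θ)
      (P.indTToTensor_comp_tensorToIndT θ) (P.tensorToIndT_comp_indTToTensor θ))
    (P.indTToTensor_comp_indT θ), fun g v => ?_⟩
  have h := LinearMap.congr_fun (P.indTToTensor_comp_indT θ g) (SplitBNPair.indT.one P θ v)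
  rw [LinearMap.comp_apply, LinearMap.comp_apply, SplitBNPair.indTToTensor_mk, inv_one, map_one,
    Module.End.one_apply] at h
  exact h
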